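/- **Setting.** A quantum channel is a completely positive trace-preserving linear map on single-qubit operators. For a noisy operation $\tilde\Lambda$ and an ideal operation $\Lambda$ let $\bar F(\tilde\Lambda)=\int d\psi\,\mathrm{Tr}\big[\tilde\Lambda(|\psi\rangle\langle\psi|)\,\Lambda(|\psi\rangle\langle\psi|)\big]$ be the average fidelity, where $d\psi$ is the normalised Haar measure on pure qubit states. Fix a depth $\kappa\ge 1$ and a string $\vec c_\kappa=(C_1,\dots,C_\kappa)$ of single-qubit Clifford gates. Let $\tilde M_1,\dots,\tilde M_\kappa$ (noisy memories, including the teleportation; the ideal memory is the identity channel) and $\tilde C_1,\dots,\tilde C_\kappa$ (noisy versions of the gates $C_j$) be arbitrary quantum channels, and let $\tilde{\mathcal T}_\kappa=\tilde C_\kappa\circ\tilde M_\kappa\circ\cdots\circ\tilde C_1\circ\tilde M_1$. In each of $n\ge1$ independent executions of the teleportation-based ping-pong test, a state $|\psi\rangle$ is drawn uniformly from the six Pauli eigenstates, $\tilde{\mathcal T}_\kappa$ is applied to it, and the execution is won with probability $\mathrm{Tr}\big[\tilde{\mathcal T}_\kappa(|\psi\rangle\langle\psi|)\;C_\kappa\circ\cdots\circ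 C_1(|\psi\rangle\langle\psi|)\big]$. Let $R_{\vec c_\kappa,\kappa}$ be the winning rate, i.e. the number of wins divided by $n$. **Theorem (consistency check).** Let $r_{M_j}$ and $r_{C_j}$, $j=1,\dots,\kappa$, be estimates (possibly random, and possibly correlated with the test) of the average fidelities $\bar F(\tilde M_j)$ and $\bar F(\tilde C_j)$, and put $$\theta=\sum_{j=1}^{\kappa}\left(\arccos\sqrt{\tfrac{3r_{M_j}-1}{2}}+\arccos\sqrt{\tfrac{3r_{C_j}-1}{2}}\right)$$ (the square root of a negative number is read as $0$). Then for every $\varepsilon>0$, with probability at least $1-2e^{-2n\varepsilon^2}$ the following holds: if none of the estimates exceeds the average fidelity that it estimates (in particular, if the estimates are exact), and if $\theta\le\pi/2$, then $$R_{\vec c_\kappa,\kappa}\;\ge\;\frac{2\cos^2\theta+1}{3}-\varepsilon .$$ -/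

import Mathlib

open MeasureTheory ProbabilityTheory
open scoped Matrix ComplexOrder

noncomputable section

namespace PingPong

/-! ### Qubit operators and quantum channels -/

/-- Operators on a single qubit. -/
abbrev QubitOp : Type := Matrix (Fin 2) (Fin 2) ℂ

/-- Linear maps acting on single-qubit operators. -/
abbrev QubitMap : Type := QubitOp →ₗ[ℂ] QubitOp

/-- The map `id ⊗ Φ` on operators of `ℂ^m ⊗ ℂ^2`: `Φ` is applied to every `2 × 2` block. -/
def ampliate (m : ℕ) (Φ : QubitMap) (X : Matrix (Fin m × Fin 2) (Fin m × Fin 2) ℂ) :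
    Matrix (Fin m × Fin 2) (Fin m × Fin 2) ℂ :=
  Matrix.of fun a b => Φ (Matrix.of fun k l => X (a.1, k) (b.1, l)) a.2 b.2

/-- A quantum channel: a completely positive, trace-preserving linear map. -/
structure IsChannel (Φ : QubitMap) : Prop where
  completelyPositive : ∀ (m : ℕ) (X : Matrix (Fin m × Fin 2) (Fin m × Fin 2) ℂ),
    X.PosSemidef → (ampliate m Φ X).PosSemidef
  tracePreserving : ∀ X : QubitOp, (Φ X).trace = X.trace

/-- The unitary channel `X ↦ U X U†`. -/
def unitaryMap (U : Matrix.unitaryGroup (Fin 2) ℂ) : QubitMap where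
  toFun X := (U : QubitOp) * X * (U : QubitOp)ᴴ
  map_add' X Y := by rw [Matrix.mul_add, Matrix.add_mul]
  map_smul' c X := by simp

/-- The three Pauli matrices `X`, `Y`, `Z`. -/
def pauli : Fin 3 → QubitOp :=
  ![!![0, 1; 1, 0], !![0, -Complex.I; Complex.I, 0], !![1, 0; 0, -1]]

/-- A single-qubit Clifford gate: a unitary which conjugates every Pauli matrix to a Pauli matrix
up to sign. -/
def IsClifford (U : Matrix.unitaryGroup (Fin 2) ℂ) : Prop :=
  ∀ a : Fin 3, ∃ b : Fin 3, unitaryMap U (pauli a) = pauli b ∨ unitaryMap U (pauli a) = -pauli b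

/-- Labels of the six Pauli eigenstates: a Pauli matrix and the sign of its eigenvalue. -/
abbrev PauliLabel : Type := Fin 3 × Bool

/-- The density operator `(1 ± σ) / 2`, i.e. the rank-one projector onto the eigenvector of the
Pauli matrix `σ` for the eigenvalue `+1` (label `true`) or `-1` (label `false`). -/
def pauliState (s : PauliLabel) : QubitOp :=
  (1 / 2 : ℂ) • (1 + (if s.2 then (1 : ℂ) else -1) • pauli s.1)

/-! ### The Haar measure on pure states -/

instance : MeasurableSpace (Matrix.unitaryGroup (Fin 2) ℂ) := borel _

instance : BorelSpace (Matrix.unitaryGroup (Fin 2) ℂ) := ⟨rfl⟩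

instance : CompactSpace (Matrix.unitaryGroup (Fin 2) ℂ) := by
  refine isCompact_iff_compactSpace.mp ?_
  have hK : IsCompact (Set.univ.pi fun _ : Fin 2 => Set.univ.pi fun _ : Fin 2 =>
      Metric.closedBall (0 : ℂ) 1) :=
    isCompact_univ_pi fun _ => isCompact_univ_pi fun _ => isCompact_closedBall _ _
  have hc : IsClosed (Matrix.unitaryGroup (Fin 2) ℂ : Set QubitOp) :=
    isClosed_unitary (R := QubitOp)
  refine IsCompact.of_isClosed_subset (X := QubitOp) hK hc ?_
  intro U hU i _ j _
  simpa using entry_norm_bound_of_unitary hU i j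

/-- The normalised Haar measure on the unitary group `U(2)`. -/
def haarU : Measure (Matrix.unitaryGroup (Fin 2) ℂ) := Measure.haarMeasure ⊤

/-- The projector `U |0⟩⟨0| U†` onto the pure state `U |0⟩`; for Haar-distributed `U` this is a
Haar-random pure state. -/
def pureState (U : Matrix.unitaryGroup (Fin 2) ℂ) : QubitOp :=
  unitaryMap U (Matrix.single 0 0 1)

/-- The average fidelity `∫ dψ Tr[Φ(|ψ⟩⟨ψ|) · Λ(|ψ⟩⟨ψ|)]` of the noisy operation `Φ` to the ideal
operation `Λ`, over Haar-random pure states. -/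
def avgFidelity (Φ Λ : QubitMap) : ℝ :=
  ∫ U, ((Φ (pureState U) * Λ (pureState U)).trace).re ∂haarU

/-! ### The teleportation-based ping-pong test -/

/-- The composition `G_κ ∘ ⋯ ∘ G_1` (the operation with the smallest index acts first). -/
def compose : (κ : ℕ) → (Fin κ → QubitMap) → QubitMap
  | 0, _ => LinearMap.id
  | κ + 1, G => G (Fin.last κ) ∘ₗ compose κ fun j => G j.castSucc

/-- The noisy test of depth `κ`: in every round `j` the noisy memory `M j` (including the
teleportation) and then the noisy gate `G j` is applied. -/
def noisyTest (κ : ℕ) (M G : Fin κ → QubitMap) : QubitMap :=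
  compose κ fun j => G j ∘ₗ M j

/-- The accepting projector `C_κ ∘ ⋯ ∘ C_1 (|ψ⟩⟨ψ|)` of the verifier for the input state `ρ`. -/
def acceptOp (κ : ℕ) (C : Fin κ → Matrix.unitaryGroup (Fin 2) ℂ) (ρ : QubitOp) : QubitOp :=
  compose κ (fun j => unitaryMap (C j)) ρ

/-- The probability that the verifier accepts when the prepared state is `s`. -/
def winProb (κ : ℕ) (C : Fin κ → Matrix.unitaryGroup (Fin 2) ℂ) (M G : Fin κ → QubitMap)
    (s : PauliLabel) : ℝ :=
  ((noisyTest κ M G (pauliState s) * acceptOp κ C (pauliState s)).trace).re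

/-- `n` executions of the test of depth `κ` with the gate string `C`, run with noisy memories `M`
and noisy gates `G`. In execution `i` the verifier prepares the Pauli state `ψ i` and records the
bit `v i` (`true` is a win). The executions are independent, each prepared state is uniform on the
six Pauli states, and given the prepared state a win has the probability of the Born rule. -/
structure IsTestRun {Ω : Type*} [MeasurableSpace Ω] (μ : Measure Ω) (κ : ℕ)
    (C : Fin κ → Matrix.unitaryGroup (Fin 2) ℂ) (M G : Fin κ → QubitMap) (n : ℕ)
    (ψ : Fin n → Ω → PauliLabel) (v : Fin n → Ω → Bool) : Prop where
  measurable_state : ∀ i, Measurable (ψ i)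
  measurable_outcome : ∀ i, Measurable (v i)
  indep : iIndepFun (fun i ω => (ψ i ω, v i ω)) μ
  uniform : ∀ i s, μ.real {ω | ψ i ω = s} = 1 / 6
  born : ∀ i s, μ.real {ω | ψ i ω = s ∧ v i ω = true} =
    μ.real {ω | ψ i ω = s} * winProb κ C M G s

/-- The winning rate: the number of wins divided by the number of executions. -/
def winningRate {Ω : Type*} {n : ℕ} (v : Fin n → Ω → Bool) (ω : Ω) : ℝ :=
  (1 / (n : ℝ)) * ∑ i, if v i ω then (1 : ℝ) else 0

/-- The sum over all rounds of the angles `acos √((3 r - 1) / 2)` of the memory and the gate. -/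
def angleSum {κ : ℕ} (rM rC : Fin κ → ℝ) : ℝ :=
  ∑ j, (Real.arccos (Real.sqrt ((3 * rM j - 1) / 2)) +
    Real.arccos (Real.sqrt ((3 * rC j - 1) / 2)))

end PingPong

end

/-! The expected winning rate is the fidelity of the noisy test averaged over the six Pauli
eigenstates. These states form a 2-design, so this average agrees with the Haar average
(`avgFidelity_eq_pauliFidelity`). For a channel with Kraus operators `K i` and an ideal unitary `W`,
a fidelity `f` satisfies `(3 f - 1) / 2 = ∑ i, ‖tr (W† K i) / 2‖ ^ 2`, the entanglement fidelity
(`HasKraus.pauliFidelity_eq`). The angle `arccos √((3 f - 1) / 2)` is subadditive under composition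
(`arccos_sqrt_sum_le`). Hence the angle of the whole test is at most the sum over all memories and
gates, and underestimated fidelities only increase that sum. This bounds the expected rate from
below by a deterministic argument. Hoeffding's inequality controls the deviation of the observed
rate; its bad event does not involve the estimates, so their correlation with the test is harmless.
-/

namespace PingPong

/-! ### Kraus representations -/

/-- The family `K` is a Kraus representation of `Φ`. -/
def HasKraus {ι : Type*} [Fintype ι] (Φ : QubitMap) (K : ι → QubitOp) : Prop :=
  ∀ X, Φ X = ∑ i, K i * X * (K i)ᴴ

/-- The sum of the squared norms of all entries of a family of matrices. -/
noncomputable def sqNorm {ι : Type*} [Fintype ι] (K : ι → QubitOp) : ℝ :=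
  ∑ i, ∑ k, ∑ l, ‖K i k l‖ ^ 2

lemma IsChannel.exists_hasKraus {Φ : QubitMap} (h : IsChannel Φ) :
    ∃ (m : ℕ) (K : Fin m → QubitOp), HasKraus Φ K := by
  -- `w` is the unnormalised maximally entangled vector. Decomposing the Choi matrix into rank-one
  -- terms and reshaping their vectors gives the Kraus operators.
  let w : Fin 2 × Fin 2 → ℂ := fun a => if a.1 = a.2 then 1 else 0
  obtain ⟨m, v, hv⟩ := Matrix.posSemidef_iff_eq_sum_vecMulVec.mp
    (h.completelyPositive 2 _ (Matrix.posSemidef_vecMulVec_self_star w))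
  refine ⟨m, fun i => Matrix.of fun a b => v i (b, a), fun X => ?_⟩
  have key : ∀ k l a b, Φ (Matrix.single k l 1) a b = ∑ i, v i (k, a) * star (v i (l, b)) := by
    intro k l a b
    have h1 := congrFun (congrFun hv (k, a)) (l, b)
    have h2 : (Matrix.of fun k' l' => Matrix.vecMulVec w (star w) (k, k') (l, l')) =
        Matrix.single k l (1 : ℂ) := by
      ext i j
      simp [Matrix.vecMulVec_apply, w, Matrix.single_apply]
      aesop
    simp only [ampliate, Matrix.of_apply, h2] at h1
    rw [h1, Matrix.sum_apply]
    rfl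
  have hX : Φ X = ∑ k, ∑ l, X k l • Φ (Matrix.single k l 1) := by
    conv_lhs => rw [Matrix.matrix_eq_sum_single X]
    simp only [map_sum]
    refine Finset.sum_congr rfl fun k _ => Finset.sum_congr rfl fun l _ => ?_
    rw [← map_smul]; simp
  ext a b
  rw [hX]
  simp only [Fin.sum_univ_two, Matrix.add_apply, Matrix.smul_apply, key, Matrix.sum_apply,
    smul_eq_mul, Finset.mul_sum, ← Finset.sum_add_distrib]
  refine Finset.sum_congr rfl fun i _ => ?_
  simp [Matrix.mul_apply]
  ring

lemma trace_mul_conjTranspose_re (A : QubitOp) :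
    ((A * Aᴴ).trace).re = ∑ k, ∑ l, ‖A k l‖ ^ 2 := by
  simp [Matrix.trace, Matrix.mul_apply, Fin.sum_univ_two, Complex.sq_norm, Complex.normSq_apply]

lemma HasKraus.sqNorm_eq {ι : Type*} [Fintype ι] {Φ : QubitMap} {K : ι → QubitOp}
    (hK : HasKraus Φ K) (h : IsChannel Φ) : sqNorm K = 2 := by
  have h1 := h.tracePreserving 1
  rw [hK 1, Matrix.trace_sum] at h1
  have h2 := congrArg Complex.re h1
  simp only [mul_one, Complex.re_sum, trace_mul_conjTranspose_re] at h2
  rw [sqNorm, h2]; simp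

lemma HasKraus.comp {ι κ : Type*} [Fintype ι] [Fintype κ] {Φ Ψ : QubitMap} {K : ι → QubitOp}
    {L : κ → QubitOp} (hK : HasKraus Φ K) (hL : HasKraus Ψ L) :
    HasKraus (Φ ∘ₗ Ψ) fun p : ι × κ => K p.1 * L p.2 := by
  intro X
  rw [LinearMap.comp_apply, hL, hK, Fintype.sum_prod_type]
  refine Finset.sum_congr rfl fun i _ => ?_
  simp only [Finset.mul_sum, Finset.sum_mul, Matrix.conjTranspose_mul, Matrix.mul_assoc]

lemma IsChannel.comp {Φ Ψ : QubitMap} (hΦ : IsChannel Φ) (hΨ : IsChannel Ψ) :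
    IsChannel (Φ ∘ₗ Ψ) where
  completelyPositive m X hX := hΦ.completelyPositive m _ (hΨ.completelyPositive m X hX)
  tracePreserving X := by
    rw [LinearMap.comp_apply, hΦ.tracePreserving, hΨ.tracePreserving]

lemma isChannel_id : IsChannel LinearMap.id where
  completelyPositive _ _ hX := hX
  tracePreserving _ := rfl

lemma unitaryMap_mul (U V : Matrix.unitaryGroup (Fin 2) ℂ) :
    unitaryMap (U * V) = unitaryMap U ∘ₗ unitaryMap V := by
  ext1 X
  simp [unitaryMap, Matrix.mul_assoc]

lemma unitaryMap_one : unitaryMap 1 = LinearMap.id := by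
  ext1 X
  simp [unitaryMap]

/-! ### The fidelity over the Pauli eigenstates -/

/-- The average fidelity of `Φ` to `Λ` over the six Pauli eigenstates. -/
noncomputable def pauliFidelity (Φ Λ : QubitMap) : ℝ :=
  1 / 6 * ∑ s, ((Φ (pauliState s) * Λ (pauliState s)).trace).re

/-- The 2-design identity: up to normalisation, the right-hand side is also the Haar average of
`|⟨ψ|A|ψ⟩|²`. -/
lemma sum_pauliState_trace (A : QubitOp) :
    ∑ s, ((A * pauliState s * Aᴴ * pauliState s).trace).re =
      ‖A.trace‖ ^ 2 + ∑ k, ∑ l, ‖A k l‖ ^ 2 := by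
  simp [Fintype.sum_prod_type, Fin.sum_univ_three, pauliState, pauli, Matrix.trace,
    Matrix.mul_apply, Fin.sum_univ_two, Complex.sq_norm, Complex.normSq_apply, Matrix.one_apply]
  ring

/-- Absorbing `W†` into the Kraus operators reduces fidelity to `W` to fidelity to the identity. -/
lemma trace_unitary_conj (W : Matrix.unitaryGroup (Fin 2) ℂ) (K P : QubitOp) :
    (K * P * Kᴴ * ((W : QubitOp) * P * (W : QubitOp)ᴴ)).trace =
      (((W : QubitOp)ᴴ * K) * P * ((W : QubitOp)ᴴ * K)ᴴ * P).trace := by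
  rw [Matrix.conjTranspose_mul, Matrix.conjTranspose_conjTranspose, ← Matrix.mul_assoc,
    Matrix.trace_mul_comm]
  simp only [Matrix.mul_assoc]

lemma unitary_conjTranspose_mul (U : Matrix.unitaryGroup (Fin 2) ℂ) :
    (U : QubitOp)ᴴ * (U : QubitOp) = 1 := Matrix.mem_unitaryGroup_iff'.mp U.2

lemma unitary_mul_conjTranspose (U : Matrix.unitaryGroup (Fin 2) ℂ) :
    (U : QubitOp) * (U : QubitOp)ᴴ = 1 := Matrix.mem_unitaryGroup_iff.mp U.2

lemma sqNorm_mul_conjTranspose {ι : Type*} [Fintype ι] (K : ι → QubitOp)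
    (W : Matrix.unitaryGroup (Fin 2) ℂ) :
    sqNorm (fun i => K i * (W : QubitOp)ᴴ) = sqNorm K := by
  refine Finset.sum_congr rfl fun i _ => ?_
  rw [← trace_mul_conjTranspose_re, ← trace_mul_conjTranspose_re, Matrix.conjTranspose_mul,
    Matrix.conjTranspose_conjTranspose, Matrix.mul_assoc, ← Matrix.mul_assoc _ _ (K i)ᴴ,
    unitary_conjTranspose_mul, Matrix.one_mul]

lemma sqNorm_conjTranspose_mul {ι : Type*} [Fintype ι] (K : ι → QubitOp)
    (W : Matrix.unitaryGroup (Fin 2) ℂ) :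
    sqNorm (fun i => (W : QubitOp)ᴴ * K i) = sqNorm K := by
  refine Finset.sum_congr rfl fun i _ => ?_
  rw [← trace_mul_conjTranspose_re, ← trace_mul_conjTranspose_re, Matrix.conjTranspose_mul,
    Matrix.conjTranspose_conjTranspose, Matrix.trace_mul_comm, Matrix.mul_assoc,
    ← Matrix.mul_assoc (W : QubitOp), unitary_mul_conjTranspose, Matrix.one_mul,
    Matrix.trace_mul_comm]

lemma HasKraus.pauliFidelity_eq {ι : Type*} [Fintype ι] {Φ : QubitMap} {K : ι → QubitOp}
    (hK : HasKraus Φ K) (h : IsChannel Φ) (W : Matrix.unitaryGroup (Fin 2) ℂ) :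
    (3 * pauliFidelity Φ (unitaryMap W) - 1) / 2 =
      ∑ i, ‖((W : QubitOp)ᴴ * K i).trace / 2‖ ^ 2 := by
  have h1 : ∑ s, ((Φ (pauliState s) * unitaryMap W (pauliState s)).trace).re =
      ∑ i, ‖((W : QubitOp)ᴴ * K i).trace‖ ^ 2 + 2 := by
    rw [← hK.sqNorm_eq h, ← sqNorm_conjTranspose_mul K W, sqNorm, ← Finset.sum_add_distrib]
    simp_rw [← sum_pauliState_trace]
    rw [Finset.sum_comm]
    refine Finset.sum_congr rfl fun s _ => ?_
    simp_rw [← trace_unitary_conj, ← Complex.re_sum, ← Matrix.trace_sum]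
    rw [hK, Finset.sum_mul]
    rfl
  rw [pauliFidelity, h1]
  simp only [norm_div, div_pow, ← Finset.sum_div]
  norm_num
  ring

/-! ### The triangle inequality for the Bures angle -/

/-- The deficit is half the squared Frobenius norm of the traceless part of `A`. -/
lemma deficit_eq (A : QubitOp) : (∑ k, ∑ l, ‖A k l‖ ^ 2) / 2 - ‖A.trace / 2‖ ^ 2 =
    ‖(A 0 0 - A 1 1) / 2‖ ^ 2 + ‖A 0 1‖ ^ 2 / 2 + ‖A 1 0‖ ^ 2 / 2 := by
  simp only [norm_div, div_pow]
  simp [Matrix.trace, Fin.sum_univ_two, Complex.sq_norm, Complex.normSq_apply]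
  ring

/-- With `A₀`, `B₀` the traceless parts, the difference on the left is `tr (A₀ B₀) / 2`, so this is
Cauchy–Schwarz. -/
lemma norm_trace_mul_sub_le (A B : QubitOp) :
    ‖(A * B).trace / 2 - A.trace / 2 * (B.trace / 2)‖ ^ 2 ≤
      ((∑ k, ∑ l, ‖A k l‖ ^ 2) / 2 - ‖A.trace / 2‖ ^ 2) *
        ((∑ k, ∑ l, ‖B k l‖ ^ 2) / 2 - ‖B.trace / 2‖ ^ 2) := by
  set a := (A 0 0 - A 1 1) / 2 with ha
  set b := (B 0 0 - B 1 1) / 2 with hb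
  have e1 : (A * B).trace / 2 - A.trace / 2 * (B.trace / 2) =
      a * b + A 0 1 * B 1 0 / 2 + A 1 0 * B 0 1 / 2 := by
    simp [Matrix.trace, Matrix.mul_apply, Fin.sum_univ_two, ha, hb]; ring
  rw [e1, deficit_eq, deficit_eq, ← ha, ← hb]
  have e3 : ‖a * b + A 0 1 * B 1 0 / 2 + A 1 0 * B 0 1 / 2‖ ≤
      ‖a‖ * ‖b‖ + ‖A 0 1‖ * ‖B 1 0‖ / 2 + ‖A 1 0‖ * ‖B 0 1‖ / 2 := by
    refine (norm_add₃_le).trans_eq ?_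
    simp
  refine (pow_le_pow_left₀ (norm_nonneg _) e3 2).trans ?_
  -- The last three squares are the remainder terms of Lagrange's identity.
  nlinarith [sq_nonneg (‖a‖ * ‖B 0 1‖ - ‖A 0 1‖ * ‖b‖), sq_nonneg (‖a‖ * ‖B 1 0‖ - ‖A 0 1‖ * ‖b‖),
    sq_nonneg (‖a‖ * ‖B 0 1‖ - ‖A 1 0‖ * ‖b‖), sq_nonneg (‖A 0 1‖ * ‖B 0 1‖ - ‖A 1 0‖ * ‖B 1 0‖)]

lemma sum_deficit {ι : Type*} [Fintype ι] (K : ι → QubitOp) (hK : sqNorm K = 2) :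
    ∑ i, ((∑ k, ∑ l, ‖K i k l‖ ^ 2) / 2 - ‖(K i).trace / 2‖ ^ 2) =
      1 - ∑ i, ‖(K i).trace / 2‖ ^ 2 := by
  rw [sqNorm] at hK
  rw [Finset.sum_sub_distrib, ← Finset.sum_div, hK]
  norm_num

lemma deficit_nonneg (A : QubitOp) :
    0 ≤ (∑ k, ∑ l, ‖A k l‖ ^ 2) / 2 - ‖A.trace / 2‖ ^ 2 := by
  rw [deficit_eq]
  positivity

lemma sqrt_sum_sq_le {ν : Type*} [Fintype ν] (u w : ν → ℂ) :
    Real.sqrt (∑ i, ‖u i‖ ^ 2) ≤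
      Real.sqrt (∑ i, ‖w i‖ ^ 2) + Real.sqrt (∑ i, ‖w i - u i‖ ^ 2) := by
  have h := norm_sub_le (WithLp.toLp 2 w : EuclideanSpace ℂ ν) (WithLp.toLp 2 (w - u))
  rw [← WithLp.toLp_sub, sub_sub_cancel] at h
  simpa [EuclideanSpace.norm_eq] using h

/-- With `x`, `y`, `z` the sums for `A`, `B` and the products, Cauchy–Schwarz for each pair and the
`ℓ²` triangle inequality give `√(x y) ≤ √z + √((1 - x) (1 - y))`. By the addition formula this says
`cos (α + β) ≤ √z`. -/
lemma arccos_sqrt_sum_le {ι κ : Type*} [Fintype ι] [Fintype κ] (A : ι → QubitOp) (B : κ → QubitOp)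
    (hA : sqNorm A = 2) (hB : sqNorm B = 2) :
    Real.arccos (Real.sqrt (∑ p : ι × κ, ‖(A p.1 * B p.2).trace / 2‖ ^ 2)) ≤
      Real.arccos (Real.sqrt (∑ i, ‖(A i).trace / 2‖ ^ 2)) +
        Real.arccos (Real.sqrt (∑ j, ‖(B j).trace / 2‖ ^ 2)) := by
  have dA := sum_deficit A hA
  have dB := sum_deficit B hB
  have hx1 := Finset.sum_nonneg fun i (_ : i ∈ Finset.univ) => deficit_nonneg (A i)
  have hy1 := Finset.sum_nonneg fun i (_ : i ∈ Finset.univ) => deficit_nonneg (B i)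
  have h1 := sqrt_sum_sq_le (fun p : ι × κ => (A p.1).trace / 2 * ((B p.2).trace / 2))
    fun p => (A p.1 * B p.2).trace / 2
  have h2 : ∑ p : ι × κ,
      ‖(A p.1 * B p.2).trace / 2 - (A p.1).trace / 2 * ((B p.2).trace / 2)‖ ^ 2 ≤
      (1 - ∑ i, ‖(A i).trace / 2‖ ^ 2) * (1 - ∑ j, ‖(B j).trace / 2‖ ^ 2) := by
    rw [← dA, ← dB, Fintype.sum_mul_sum, ← Fintype.sum_prod_type']
    exact Finset.sum_le_sum fun p _ => norm_trace_mul_sub_le _ _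
  have h3 : ∑ p : ι × κ, ‖(A p.1).trace / 2 * ((B p.2).trace / 2)‖ ^ 2 =
      (∑ i, ‖(A i).trace / 2‖ ^ 2) * ∑ j, ‖(B j).trace / 2‖ ^ 2 := by
    rw [Fintype.sum_mul_sum, ← Fintype.sum_prod_type']
    simp only [norm_mul, mul_pow]
  rw [dA] at hx1
  rw [dB] at hy1
  have hx0 : 0 ≤ ∑ i, ‖(A i).trace / 2‖ ^ 2 := by positivity
  have hy0 : 0 ≤ ∑ j, ‖(B j).trace / 2‖ ^ 2 := by positivity
  rw [h3] at h1
  generalize ∑ i, ‖(A i).trace / 2‖ ^ 2 = x at *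
  generalize ∑ j, ‖(B j).trace / 2‖ ^ 2 = y at *
  have h4 := h1.trans (add_le_add_right (Real.sqrt_le_sqrt h2) _)
  rw [Real.sqrt_mul hx0, Real.sqrt_mul hx1] at h4
  have ax : Real.sqrt x ≤ 1 := Real.sqrt_le_one.mpr (by linarith)
  have ay : Real.sqrt y ≤ 1 := Real.sqrt_le_one.mpr (by linarith)
  have hcos : Real.cos (Real.arccos (Real.sqrt x) + Real.arccos (Real.sqrt y)) ≤
      Real.sqrt (∑ p : ι × κ, ‖(A p.1 * B p.2).trace / 2‖ ^ 2) := by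
    rw [Real.cos_add, Real.sin_arccos, Real.sin_arccos, Real.sq_sqrt hx0, Real.sq_sqrt hy0,
      Real.cos_arccos (by linarith [Real.sqrt_nonneg x]) ax,
      Real.cos_arccos (by linarith [Real.sqrt_nonneg y]) ay]
    linarith
  refine (Real.arccos_le_arccos hcos).trans_eq (Real.arccos_cos ?_ ?_)
  · exact add_nonneg (Real.arccos_nonneg _) (Real.arccos_nonneg _)
  · have := Real.arccos_le_pi_div_two.mpr (Real.sqrt_nonneg x)
    have := Real.arccos_le_pi_div_two.mpr (Real.sqrt_nonneg y)
    linarith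

/-- The Bures angle `acos √F` for the entanglement fidelity `F = (3 f - 1) / 2` that belongs to the
average fidelity `f` of `Φ` to `Λ`. -/
noncomputable def buresAngle (Φ Λ : QubitMap) : ℝ :=
  Real.arccos (Real.sqrt ((3 * pauliFidelity Φ Λ - 1) / 2))

lemma buresAngle_comp_le {Φ Ψ : QubitMap} (hΦ : IsChannel Φ) (hΨ : IsChannel Ψ)
    (U V : Matrix.unitaryGroup (Fin 2) ℂ) :
    buresAngle (Φ ∘ₗ Ψ) (unitaryMap (U * V)) ≤
      buresAngle Φ (unitaryMap U) + buresAngle Ψ (unitaryMap V) := by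
  obtain ⟨m, K, hK⟩ := hΦ.exists_hasKraus
  obtain ⟨n, L, hL⟩ := hΨ.exists_hasKraus
  -- `V†` stands on the right of `L j` because `tr (V† U† K L) = tr (U† K · L V†)` by cyclicity.
  have h := arccos_sqrt_sum_le (fun i => (U : QubitOp)ᴴ * K i) (fun j => L j * (V : QubitOp)ᴴ)
    ((sqNorm_conjTranspose_mul K U).trans (hK.sqNorm_eq hΦ))
    ((sqNorm_mul_conjTranspose L V).trans (hL.sqNorm_eq hΨ))
  rw [buresAngle, buresAngle, buresAngle, hK.pauliFidelity_eq hΦ, hL.pauliFidelity_eq hΨ,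
    (hK.comp hL).pauliFidelity_eq (hΦ.comp hΨ)]
  convert h using 7 with p _ j _
  · simp only [Submonoid.coe_mul, Matrix.conjTranspose_mul, Matrix.mul_assoc]
    rw [Matrix.trace_mul_comm]
    simp only [Matrix.mul_assoc]
  · rw [Matrix.trace_mul_comm]

lemma buresAngle_id : buresAngle LinearMap.id LinearMap.id = 0 := by
  have hK : HasKraus LinearMap.id fun _ : Unit => (1 : QubitOp) := fun X => by simp
  have h := hK.pauliFidelity_eq isChannel_id 1
  rw [unitaryMap_one] at h
  rw [buresAngle, h]
  simp

/-- The test realises a channel whose Bures angle to the ideal operation, a unitary channel, is at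
most the sum of the Bures angles of the memories and gates. -/
lemma noisyTest_buresAngle_le (κ : ℕ) (C : Fin κ → Matrix.unitaryGroup (Fin 2) ℂ)
    (M G : Fin κ → QubitMap) (hM : ∀ j, IsChannel (M j)) (hG : ∀ j, IsChannel (G j)) :
    IsChannel (noisyTest κ M G) ∧ ∃ W, compose κ (fun j => unitaryMap (C j)) = unitaryMap W ∧
      buresAngle (noisyTest κ M G) (unitaryMap W) ≤
        ∑ j, (buresAngle (M j) LinearMap.id + buresAngle (G j) (unitaryMap (C j))) := by
  induction κ with
  | zero =>
    refine ⟨isChannel_id, 1, unitaryMap_one.symm, ?_⟩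
    rw [unitaryMap_one]
    exact buresAngle_id.le.trans_eq (by simp)
  | succ κ ih =>
    obtain ⟨h1, W, h2, h3⟩ := ih (fun j => C j.castSucc) (fun j => M j.castSucc)
      (fun j => G j.castSucc) (fun j => hM _) fun j => hG _
    have hR := (hG (Fin.last κ)).comp (hM (Fin.last κ))
    refine ⟨hR.comp h1, C (Fin.last κ) * W, ?_, ?_⟩
    · rw [unitaryMap_mul, ← h2]; rfl
    · have h4 := buresAngle_comp_le hR h1 (C (Fin.last κ)) W
      -- Within a round, the ideal memory is the unitary channel of `1`.
      have h5 := buresAngle_comp_le (hG (Fin.last κ)) (hM (Fin.last κ)) (C (Fin.last κ)) 1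
      rw [mul_one, unitaryMap_one] at h5
      rw [Fin.sum_univ_castSucc]
      exact h4.trans (by linarith)

lemma three_mul_pauliFidelity_sub_one_mem {Φ : QubitMap} (h : IsChannel Φ)
    (W : Matrix.unitaryGroup (Fin 2) ℂ) :
    (3 * pauliFidelity Φ (unitaryMap W) - 1) / 2 ∈ Set.Icc (0 : ℝ) 1 := by
  obtain ⟨m, K, hK⟩ := h.exists_hasKraus
  rw [hK.pauliFidelity_eq h]
  have h1 := sum_deficit _ ((sqNorm_conjTranspose_mul K W).trans (hK.sqNorm_eq h))
  have h2 := Finset.sum_nonneg fun i (_ : i ∈ Finset.univ) =>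
    deficit_nonneg ((W : QubitOp)ᴴ * K i)
  exact ⟨by positivity, by linarith⟩

/-- If the Bures angle of a channel to a unitary channel is at most `θ ≤ π / 2`, its fidelity is
at least `(2 cos² θ + 1) / 3`. -/
lemma le_pauliFidelity {Φ : QubitMap} (h : IsChannel Φ) (W : Matrix.unitaryGroup (Fin 2) ℂ)
    {θ : ℝ} (hθ : buresAngle Φ (unitaryMap W) ≤ θ) (hπ : θ ≤ Real.pi / 2) :
    (2 * Real.cos θ ^ 2 + 1) / 3 ≤ pauliFidelity Φ (unitaryMap W) := by
  obtain ⟨h0, h1⟩ := three_mul_pauliFidelity_sub_one_mem h W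
  have hnn : 0 ≤ buresAngle Φ (unitaryMap W) := Real.arccos_nonneg _
  have h2 : Real.cos θ ≤ Real.cos (buresAngle Φ (unitaryMap W)) :=
    Real.cos_le_cos_of_nonneg_of_le_pi hnn (by linarith [Real.pi_pos]) hθ
  rw [buresAngle, Real.cos_arccos (neg_one_lt_zero.le.trans (Real.sqrt_nonneg _))
    (Real.sqrt_le_one.mpr h1)] at h2
  -- Squaring needs `cos θ ≥ 0`, which is where `θ ≤ π / 2` enters.
  have h3 := pow_le_pow_left₀
    (Real.cos_nonneg_of_neg_pi_div_two_le_of_le (by linarith [Real.pi_pos]) hπ) h2 2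
  rw [Real.sq_sqrt h0] at h3
  linarith

/-! ### The average fidelity as an average over the Pauli eigenstates -/

lemma unitaryMap_apply (U : Matrix.unitaryGroup (Fin 2) ℂ) (X : QubitOp) (i j : Fin 2) :
    unitaryMap U X i j = ∑ k, (∑ l, (U : QubitOp) i l * X l k) * star ((U : QubitOp) j k) := by
  simp only [unitaryMap, LinearMap.coe_mk, AddHom.coe_mk, Matrix.mul_apply,
    Matrix.conjTranspose_apply]

/-- The Hermitian operator `(1 + x X + y Y + z Z) / 2` of the Bloch vector `(x, y, z)`. -/
noncomputable def bloch (x y z : ℝ) : QubitOp :=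
  !![⟨(1 + z) / 2, 0⟩, ⟨x / 2, -y / 2⟩; ⟨x / 2, y / 2⟩, ⟨(1 - z) / 2, 0⟩]

lemma exists_pureState_eq_bloch (U : Matrix.unitaryGroup (Fin 2) ℂ) :
    ∃ x y z : ℝ, x ^ 2 + y ^ 2 + z ^ 2 = 1 ∧ pureState U = bloch x y z := by
  have h : ((U : QubitOp)ᴴ * (U : QubitOp)) 0 0 = 1 := by
    rw [unitary_conjTranspose_mul]; rfl
  have h' := congrArg Complex.re h
  simp [Matrix.mul_apply, Fin.sum_univ_two] at h'
  set a := (U : QubitOp) 0 0 with ha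
  set b := (U : QubitOp) 1 0 with hb
  refine ⟨2 * (a.re * b.re + a.im * b.im), 2 * (a.re * b.im - a.im * b.re),
    a.re ^ 2 + a.im ^ 2 - b.re ^ 2 - b.im ^ 2, ?_, ?_⟩
  · have : (a.re * a.re + a.im * a.im + (b.re * b.re + b.im * b.im)) ^ 2 = 1 := by rw [h']; norm_num
    linear_combination this
  · ext i j
    fin_cases i <;> fin_cases j <;> apply Complex.ext <;>
      simp [pureState, unitaryMap_apply, bloch, Fin.sum_univ_two, Matrix.single_apply,
        pow_two, ← ha, ← hb] <;> linarith

/-- The unitary which permutes the Pauli matrices cyclically. -/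
noncomputable def cyclicUnitary : Matrix.unitaryGroup (Fin 2) ℂ :=
  -- This is `(1 - i (X + Y + Z)) / 2`, the rotation by `2π / 3` about the axis `(1, 1, 1)`.
  ⟨!![⟨1 / 2, -1 / 2⟩, ⟨-1 / 2, -1 / 2⟩; ⟨1 / 2, -1 / 2⟩, ⟨1 / 2, 1 / 2⟩], by
    rw [Matrix.mem_unitaryGroup_iff]
    ext i j
    fin_cases i <;> fin_cases j <;> apply Complex.ext <;>
      simp [Matrix.mul_apply, Fin.sum_univ_two] <;> norm_num⟩

/-- The Pauli matrices as unitaries. -/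
noncomputable def pauliUnitary (a : Fin 3) : Matrix.unitaryGroup (Fin 2) ℂ :=
  ⟨pauli a, by
    rw [Matrix.mem_unitaryGroup_iff]
    ext i j
    fin_cases a <;> fin_cases i <;> fin_cases j <;>
      simp [pauli, Matrix.mul_apply, Fin.sum_univ_two]⟩

lemma unitaryMap_cyclicUnitary_bloch (x y z : ℝ) :
    unitaryMap cyclicUnitary (bloch x y z) = bloch z x y := by
  ext i j
  fin_cases i <;> fin_cases j <;> apply Complex.ext <;>
    simp [unitaryMap_apply, cyclicUnitary, bloch, Fin.sum_univ_two] <;> ring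

lemma unitaryMap_pauliUnitary_bloch (a : Fin 3) (x y z : ℝ) :
    unitaryMap (pauliUnitary a) (bloch x y z) =
      ![bloch x (-y) (-z), bloch (-x) y (-z), bloch (-x) (-y) z] a := by
  fin_cases a <;> ext i j <;> fin_cases i <;> fin_cases j <;> apply Complex.ext <;>
    simp [unitaryMap_apply, pauliUnitary, pauli, bloch, Fin.sum_univ_two] <;> ring

lemma pureState_mul (g U : Matrix.unitaryGroup (Fin 2) ℂ) :
    pureState (g * U) = unitaryMap g (pureState U) := by
  rw [pureState, unitaryMap_mul]; rfl

instance : IsProbabilityMeasure haarU := ⟨Measure.haarMeasure_self (K₀ := (⊤ : TopologicalSpace.PositiveCompacts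
    (Matrix.unitaryGroup (Fin 2) ℂ)))⟩

instance : haarU.IsMulLeftInvariant := by
  unfold haarU; infer_instance

lemma continuous_pureState : Continuous pureState := by
  have h : Continuous fun U : Matrix.unitaryGroup (Fin 2) ℂ => (U : QubitOp) :=
    continuous_subtype_val
  exact (h.mul continuous_const).mul h.matrix_conjTranspose

lemma integral_eq_of_sum_mul_left {ι : Type*} [Fintype ι] [Nonempty ι]
    (g : ι → Matrix.unitaryGroup (Fin 2) ℂ) {f : Matrix.unitaryGroup (Fin 2) ℂ → ℝ}
    (hf : Continuous f) {c : ℝ} (hc : ∀ U, ∑ i, f (g i * U) = Fintype.card ι * c) :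
    ∫ U, f U ∂haarU = c := by
  have h1 : ∫ U, ∑ i, f (g i * U) ∂haarU = Fintype.card ι * ∫ U, f U ∂haarU := by
    rw [integral_finsetSum]
    · simp [integral_mul_left_eq_self]
    · intro i _
      exact (hf.comp (continuous_const_mul (g i))).integrable_of_hasCompactSupport
        (HasCompactSupport.of_compactSpace _)
  simp_rw [hc] at h1
  rw [integral_const, probReal_univ, one_smul] at h1
  exact (mul_left_cancel₀ (by exact_mod_cast Fintype.card_ne_zero) h1).symm

/-- The twelve rotations of the tetrahedral group. -/
noncomputable def tetrahedral (p : Fin 3 × Fin 4) : Matrix.unitaryGroup (Fin 2) ℂ :=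
  cyclicUnitary ^ (p.1 : ℕ) * (Fin.cons 1 pauliUnitary : Fin 4 → _) p.2

/-- The integrand is a quadratic polynomial in the Bloch vector. Averaging over the twelve rotations
cancels linear and mixed terms and turns each square into `(x² + y² + z²) / 3 = 1 / 3`, giving a
constant equal to the Pauli average. -/
lemma avgFidelity_eq_pauliFidelity (Φ Λ : QubitMap) : avgFidelity Φ Λ = pauliFidelity Φ Λ := by
  have hcont : ∀ Ψ : QubitMap, Continuous Ψ := fun Ψ => Ψ.continuous_of_finiteDimensional
  refine integral_eq_of_sum_mul_left tetrahedral ?_ fun U => ?_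
  · exact Complex.continuous_re.comp
      ((((hcont Φ).comp continuous_pureState).mul ((hcont Λ).comp continuous_pureState)).matrix_trace)
  obtain ⟨x, y, z, hn, hU⟩ := exists_pureState_eq_bloch U
  have hb : ∀ (Ψ : QubitMap) (x y z : ℝ), Ψ (bloch x y z) = ((1 / 2 : ℝ) : ℂ) •
      (Ψ 1 + (x : ℂ) • Ψ (pauli 0) + (y : ℂ) • Ψ (pauli 1) + (z : ℂ) • Ψ (pauli 2)) := by
    intro Ψ x y z
    simp only [← map_smul, ← map_add]
    congr 1
    ext i j
    fin_cases i <;> fin_cases j <;> apply Complex.ext <;> simp [bloch, pauli] <;> ring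
  have hs : ∀ (Ψ : QubitMap) (s : PauliLabel), Ψ (pauliState s) = ((1 / 2 : ℝ) : ℂ) •
      (Ψ 1 + ((if s.2 then (1 : ℝ) else -1 : ℝ) : ℂ) • Ψ (pauli s.1)) := by
    intro Ψ s
    simp only [← map_smul, ← map_add, pauliState]
    split_ifs <;> simp
  simp only [pauliFidelity, Fintype.sum_prod_type, Fin.sum_univ_three, Fin.sum_univ_four,
    tetrahedral, pureState_mul, unitaryMap_mul, hU, hs, Fintype.sum_bool, Fintype.card_prod,
    Fintype.card_fin]
  simp only [Fin.val_zero, Fin.val_one, Fin.val_two, pow_zero, pow_one, pow_two, unitaryMap_mul,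
    unitaryMap_one, LinearMap.comp_apply, LinearMap.id_apply, Fin.cons_zero,
    show (1 : Fin 4) = Fin.succ 0 from rfl, show (2 : Fin 4) = Fin.succ 1 from rfl,
    show (3 : Fin 4) = Fin.succ 2 from rfl, Fin.cons_succ, unitaryMap_pauliUnitary_bloch,
    Matrix.cons_val, unitaryMap_cyclicUnitary_bloch]
  simp only [hb, Matrix.smul_mul, Matrix.mul_smul, Matrix.add_mul, Matrix.mul_add, Matrix.trace_add,
    Matrix.trace_smul, smul_eq_mul, Complex.add_re, Complex.re_ofReal_mul, smul_add]
  simp only [↓reduceIte, Bool.false_eq_true]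
  generalize ((Φ 1 * Λ 1).trace).re = b
  generalize ((Φ (pauli 0) * Λ (pauli 0)).trace).re = b₀
  generalize ((Φ (pauli 1) * Λ (pauli 1)).trace).re = b₁
  generalize ((Φ (pauli 2) * Λ (pauli 2)).trace).re = b₂
  push_cast
  linear_combination (b₀ + b₁ + b₂) * hn

/-! ### Concentration of the winning rate -/

lemma angleSum_ge_sum_buresAngle {κ : ℕ} {C : Fin κ → Matrix.unitaryGroup (Fin 2) ℂ}
    {M G : Fin κ → QubitMap} {rM rC : Fin κ → ℝ}
    (h : ∀ j, rM j ≤ avgFidelity (M j) LinearMap.id ∧ rC j ≤ avgFidelity (G j) (unitaryMap (C j))) :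
    ∑ j, (buresAngle (M j) LinearMap.id + buresAngle (G j) (unitaryMap (C j))) ≤
      angleSum rM rC := by
  simp only [avgFidelity_eq_pauliFidelity] at h
  refine Finset.sum_le_sum fun j _ => add_le_add ?_ ?_ <;>
    refine Real.arccos_le_arccos (Real.sqrt_le_sqrt ?_)
  · linarith [(h j).1]
  · linarith [(h j).2]

section Run

variable {Ω : Type*} [MeasurableSpace Ω] {μ : Measure Ω} [IsProbabilityMeasure μ] {κ : ℕ}
  {C : Fin κ → Matrix.unitaryGroup (Fin 2) ℂ} {M G : Fin κ → QubitMap} {n : ℕ}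
  {ψ : Fin n → Ω → PauliLabel} {v : Fin n → Ω → Bool}

lemma IsTestRun.measureReal_win (run : IsTestRun μ κ C M G n ψ v) (i : Fin n) :
    μ.real {ω | v i ω = true} = 1 / 6 * ∑ s, winProb κ C M G s := by
  have hU : {ω | v i ω = true} = ⋃ s, {ω | ψ i ω = s ∧ v i ω = true} := by
    ext ω; simp
  rw [hU, measureReal_iUnion_fintype, Finset.mul_sum]
  · exact Finset.sum_congr rfl fun s _ => by rw [run.born, run.uniform]
  · intro s t hst
    refine Set.disjoint_left.mpr fun ω h1 h2 => hst (h1.1.symm.trans h2.1)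
  · intro s
    exact (run.measurable_state i (measurableSet_singleton s)).inter
      (run.measurable_outcome i (measurableSet_singleton true))

lemma IsTestRun.measureReal_winningRate_lt_le (run : IsTestRun μ κ C M G n ψ v) (hn : 1 ≤ n)
    {ε : ℝ} (hε : 0 < ε) :
    μ.real {ω | winningRate v ω < 1 / 6 * ∑ s, winProb κ C M G s - ε} ≤
      Real.exp (-2 * n * ε ^ 2) := by
  set p := 1 / 6 * ∑ s, winProb κ C M G s with hp
  have hn' : (0 : ℝ) < n := by exact_mod_cast hn
  -- A win counts as `-1`, so the lower tail of the rate becomes an upper tail. The values lie in an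
  -- interval of length 1, giving variance proxy `1 / 4`.
  let g : PauliLabel × Bool → ℝ := fun x => if x.2 then -1 else 0
  let X : Fin n → Ω → ℝ := fun i ω => g (ψ i ω, v i ω)
  have hX : ∀ i, Measurable (X i) := fun i =>
    (measurable_of_countable g).comp ((run.measurable_state i).prodMk (run.measurable_outcome i))
  have hmean : ∀ i, μ[X i] = -p := by
    intro i
    have hset : MeasurableSet {ω | v i ω = true} :=
      run.measurable_outcome i (measurableSet_singleton true)
    have h1 : X i = {ω | v i ω = true}.indicator fun _ => (-1 : ℝ) := by
      ext ω; simp [X, g, Set.indicator_apply]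
    rw [h1, integral_indicator_const _ hset, run.measureReal_win i]
    simp [hp]
  have hsub : ∀ i ∈ Finset.univ, HasSubgaussianMGF (fun ω => X i ω - -p)
      ((‖(0 : ℝ) - -1‖₊ / 2) ^ 2) μ := by
    intro i _
    rw [← hmean i]
    refine hasSubgaussianMGF_of_mem_Icc (hX i).aemeasurable (ae_of_all _ fun ω => ?_)
    simp only [X, g]
    split_ifs <;> simp
  have hind : iIndepFun (fun i ω => X i ω - -p) μ :=
    run.indep.comp (fun _ x => g x - -p) fun _ => measurable_of_countable _
  have hH := HasSubgaussianMGF.measure_sum_ge_le_of_iIndepFun hind hsub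
    (ε := n * ε) (by positivity)
  refine (measureReal_mono fun ω hω => ?_).trans (hH.trans_eq ?_)
  · simp only [Set.mem_ofPred_eq, winningRate] at hω ⊢
    have h2 : ∑ i, X i ω = -∑ i, (if v i ω then (1 : ℝ) else 0) := by
      rw [← Finset.sum_neg_distrib]
      refine Finset.sum_congr rfl fun i _ => ?_
      simp only [X, g]
      split_ifs <;> simp
    rw [Finset.sum_sub_distrib, h2]
    have h3 := mul_lt_mul_of_pos_left hω hn'
    rw [← mul_assoc, mul_one_div_cancel hn'.ne', one_mul] at h3
    simp only [Finset.sum_const, Finset.card_univ, Fintype.card_fin, nsmul_eq_mul]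
    linarith
  · congr 1
    simp
    field_simp

lemma measurable_winningRate (hv : ∀ i, Measurable (v i)) : Measurable (winningRate v) := by
  refine measurable_const.mul (Finset.measurable_sum _ fun i _ => ?_)
  exact Measurable.ite (hv i (measurableSet_singleton true)) measurable_const measurable_const

end Run

lemma sum_winProb_eq {κ : ℕ} {C : Fin κ → Matrix.unitaryGroup (Fin 2) ℂ} {M G : Fin κ → QubitMap} :
    1 / 6 * ∑ s, winProb κ C M G s =
      pauliFidelity (noisyTest κ M G) (compose κ fun j => unitaryMap (C j)) := rfl

end PingPong

theorem mainTheorem5 (κ : ℕ) (hκ : 1 ≤ κ)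
    -- the fixed string of Clifford gates
    (C : Fin κ → Matrix.unitaryGroup (Fin 2) ℂ) (hC : ∀ j, PingPong.IsClifford (C j))
    -- the noisy memories and the noisy gates
    (M G : Fin κ → PingPong.QubitMap)
    (hM : ∀ j, PingPong.IsChannel (M j)) (hG : ∀ j, PingPong.IsChannel (G j))
    -- the executions of the test
    {Ω : Type*} [MeasurableSpace Ω] (μ : MeasureTheory.Measure Ω)
    [MeasureTheory.IsProbabilityMeasure μ] (n : ℕ) (hn : 1 ≤ n)
    (ψ : Fin n → Ω → PingPong.PauliLabel) (v : Fin n → Ω → Bool)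
    (run : PingPong.IsTestRun μ κ C M G n ψ v)
    -- the estimates of the average fidelities of the memories and gates
    (rM rC : Fin κ → Ω → ℝ) (ε : ℝ) (hε : 0 < ε) :
    1 - 2 * Real.exp (-2 * n * ε ^ 2) ≤
      μ.real {ω |
        (∀ j, rM j ω ≤ PingPong.avgFidelity (M j) LinearMap.id ∧
          rC j ω ≤ PingPong.avgFidelity (G j) (PingPong.unitaryMap (C j))) →
        PingPong.angleSum (fun j => rM j ω) (fun j => rC j ω) ≤ Real.pi / 2 →
        PingPong.winningRate v ω ≥
          (2 * Real.cos (PingPong.angleSum (fun j => rM j ω) (fun j => rC j ω)) ^ 2 + 1) / 3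
            - ε} := by
  open PingPong in
  obtain ⟨hT, W, hW, hθ⟩ := noisyTest_buresAngle_le κ C M G hM hG
  have hmeas : MeasurableSet {ω | winningRate v ω < 1 / 6 * ∑ s, winProb κ C M G s - ε} :=
    measurableSet_lt (measurable_winningRate run.measurable_outcome) measurable_const
  have h1 := run.measureReal_winningRate_lt_le hn hε
  have h2 := probReal_compl_eq_one_sub (μ := μ) hmeas
  have h3 := Real.exp_pos (-2 * n * ε ^ 2)
  -- The one-sided tail bound already gives `1 - exp (-2 n ε²)`, more than required. Monotonicity of
  -- the measure needs no measurability of the target event, hence none of the estimates.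
  refine le_trans (by linarith) (h2.symm.le.trans (measureReal_mono fun ω hω hr hπ => ?_))
  have h4 := le_pauliFidelity hT W (hθ.trans (angleSum_ge_sum_buresAngle hr)) hπ
  rw [← hW, ← sum_winProb_eq] at h4
  have h5 : ¬ winningRate v ω < 1 / 6 * ∑ s, winProb κ C M G s - ε := hω
  linarith
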